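/- Let $(\mathcal V,\otimes,I)$ be a monoidal category (not assumed symmetric, closed or complete), let $A,E$ be $\mathcal V$-categories, with composition $\circ\colon E(x,y)\otimes E(y,z)\to E(x,z)$, and let $j\colon A\to E$ be a $\mathcal V$-functor. For a $\mathcal V$-functor $g\colon D\to E$ write $E(1,g)$ for the $\mathcal V$-distributor $(x,z)\mapsto E(x,gz)$. A \emph{$\mathcal V$-form} $q_1,\dots,q_m\Rightarrow q$ between $\mathcal V$-distributors is a family of morphisms $q_1(z_0,z_1)\otimes\cdots\otimes q_m(z_{m-1},z_m)\to q(z_0,z_m)$ that is $\mathcal V$-natural in all of $z_0,\dots,z_m$. \textbf{Relative monads and algebras.} A \emph{$j$-monad} $T=(t,\dag,\eta)$ consists of a $\mathcal V$-functor $t\colon A\to E$, a $\mathcal V$-natural family $\dag_{x,y}\colon E(jx,ty)\to E(tx,ty)$ and a $\mathcal V$-natural transformation $\eta\colon j\Rightarrow t$, with components $\eta_x\colon I\to E(jx,tx)$, such that $E(\eta_x,ty)\cdot\dag_{x,y}=1$, $\dag_{x,x}\cdot\eta_x=\mathrm{id}_{tx}$ and $\circ\cdot(\dag_{x,y}\otimes\dag_{y,z})=\dag_{x,z}\cdot\circ\cdot(1\otimes\dag_{y,z})$.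 A \emph{$T$-algebra} with domain $D$ is a $\mathcal V$-functor $e\colon D\to E$ with a $\mathcal V$-natural family $\rtimes_{x,z}\colon E(jx,ez)\to E(tx,ez)$ such that $E(\eta_x,ez)\cdot\rtimes_{x,z}=1$ and $\circ\cdot(\dag_{x,y}\otimes\rtimes_{y,z})=\rtimes_{x,z}\cdot\circ\cdot(1\otimes\rtimes_{y,z})$; it can be precomposed with any $\mathcal V$-functor $D'\to D$. A \emph{$(p_1,\dots,p_n)$-graded morphism} ($n\ge 0$) from $(e,\rtimes)$ to $(e',\rtimes')$ is a $\mathcal V$-form $\epsilon\colon E(1,e),p_1,\dots,p_n\Rightarrow E(1,e')$ such that applying $\rtimes$ to the factor $E(jx,ez_0)$ and then $\epsilon$ equals applying $\epsilon$ and then $\rtimes'$. \textbf{Algebra objects.} An \emph{algebra object} for $T$ is a $T$-algebra $(u\colon C\to E,\rtimes_u)$ such that (1) every $T$-algebra $(e\colon D\to E,\rtimes)$ is the precomposite of $(u,\rtimes_u)$ with a unique $\mathcal V$-functor $\langle\rtimes\rangle\colon D\to C$; and (2) every graded morphism $\epsilon\colon E(1,e),p_1,\dots,p_n\Rightarrow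 E(1,e')$ of $T$-algebras is the pasting $E(1,u),\alpha$ with $u$ of a unique $\mathcal V$-form $\alpha\colon C(1,\langle\rtimes\rangle),p_1,\dots,p_n\Rightarrow C(1,\langle\rtimes'\rangle)$. \textbf{Eilenberg--Moore algebras.} An \emph{Eilenberg--Moore $T$-algebra} is an object $e$ of $E$ with morphisms $\ddag_x\colon E(jx,e)\to E(tx,e)$ ($x\in A$) such that $E(\eta_x,e)\cdot\ddag_x=1$ and $\circ\cdot(\dag_{x,y}\otimes\ddag_y)=\ddag_x\cdot\circ\cdot(1\otimes\ddag_y)$. A \emph{$v$-graded homomorphism} $(e,\ddag)\to(e',\ddag')$, for $v\in\mathcal V$, is a morphism $h\colon v\to E(e,e')$ with $\circ\cdot(1\otimes h)\cdot(\ddag_x\otimes v)=\ddag'_x\cdot\circ\cdot(1\otimes h)$ for all $x$. It is \emph{universal} if every graded homomorphism $v'\to E(e,e')$ from $(e,\ddag)$ to $(e',\ddag')$ factors uniquely through it. \textbf{Theorem.} (a) A $j$-monad $T$ admits an algebra object if and only if for all Eilenberg--Moore $T$-algebras $(e,\ddag)$, $(e',\ddag')$ there is a universal graded homomorphism $\mathrm{EM}(T)((e,\ddag),(e',\ddag'))\to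 E(e,e')$. (b) In that case, for any choice of universal graded homomorphisms, the Eilenberg--Moore $\mathcal V$-category $\mathrm{EM}(T)$, with Eilenberg--Moore $T$-algebras as objects, the domains of the universal graded homomorphisms as hom-objects, and identities and composition induced from $E$, together with its forgetful $\mathcal V$-functor to $E$ and the extension operators of the Eilenberg--Moore algebras, is an algebra object for $T$; and every algebra object for $T$ is isomorphic to it as a $T$-algebra (by an isomorphism of domains). (c) Suppose that $\mathcal V$ has equalisers and that for each object $e$ of $E$ and each $\mathcal V$-presheaf $q$ on $A$ the object of $\mathcal V$-natural transformations from $E(j{-},e)$ to $q$ exists, that is, an object $N$ of $\mathcal V$ with a $\mathcal V$-natural family $E(jx,e)\otimes N\to q(x)$ through which every $\mathcal V$-natural family $E(jx,e)\otimes v\to q(x)$ factors via a unique morphism $v\to N$. Then every $j$-monad admits an algebra object. -/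

import Mathlib

open CategoryTheory MonoidalCategory CategoryTheory.Limits

universe w v u

namespace EnrichedRelMonad

noncomputable section

section VCat

variable {V : Type v} [Category.{w} V] [MonoidalCategory V]

variable (V) in
/-- A `V`-category, bundled with its class of objects. -/
structure VCat where
  Obj : Type u
  [str : EnrichedCategory.{w} V Obj]

instance : CoeSort (VCat.{w, v, u} V) (Type u) := ⟨VCat.Obj⟩

instance (C : VCat.{w, v, u} V) : EnrichedCategory.{w} V C := C.str

/-- A `V`-distributor between `V`-categories `C` and `D`, contravariant in `C` and covariant
in `D` (a loose-cell from `D` to `C`). -/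
structure Distributor (C D : VCat.{w, v, u} V) where
  obj : C → D → V
  lact : ∀ (x' x : C) (y : D), (x' ⟶[V] x) ⊗ obj x y ⟶ obj x' y
  ract : ∀ (x : C) (y y' : D), obj x y ⊗ (y ⟶[V] y') ⟶ obj x y'
  lact_id : ∀ (x : C) (y : D),
    (λ_ (obj x y)).inv ≫ eId V x ▷ obj x y ≫ lact x x y = 𝟙 (obj x y)
  lact_comp : ∀ (x'' x' x : C) (y : D),
    eComp V x'' x' x ▷ obj x y ≫ lact x'' x y =
      (α_ _ _ _).hom ≫ (x'' ⟶[V] x') ◁ lact x' x y ≫ lact x'' x' y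
  ract_id : ∀ (x : C) (y : D),
    (ρ_ (obj x y)).inv ≫ obj x y ◁ eId V y ≫ ract x y y = 𝟙 (obj x y)
  ract_comp : ∀ (x : C) (y y' y'' : D),
    obj x y ◁ eComp V y y' y'' ≫ ract x y y'' =
      (α_ _ _ _).inv ≫ ract x y y' ▷ (y' ⟶[V] y'') ≫ ract x y' y''
  lact_ract : ∀ (x' x : C) (y y' : D),
    lact x' x y ▷ (y ⟶[V] y') ≫ ract x' y y' =
      (α_ _ _ _).hom ≫ (x' ⟶[V] x) ◁ ract x y y' ≫ lact x' x y'

/-- The restriction `X(f, g)` of the loose-identity of `X` along `V`-functors `f` and `g`. -/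
abbrev homDist {C D X : VCat.{w, v, u} V} (f : EnrichedFunctor V C X)
    (g : EnrichedFunctor V D X) : Distributor C D where
  obj x y := f.obj x ⟶[V] g.obj y
  lact x' x y := f.map x' x ▷ _ ≫ eComp V _ _ _
  ract x y y' := _ ◁ g.map y y' ≫ eComp V _ _ _
  lact_id x y := by
    rw [← comp_whiskerRight_assoc, f.map_id, e_id_comp]
  lact_comp x'' x' x y := by
    rw [← comp_whiskerRight_assoc, f.map_comp, comp_whiskerRight_assoc,
      ← e_assoc', MonoidalCategory.whiskerLeft_comp_assoc, whisker_exchange_assoc,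
      MonoidalCategory.tensorHom_def']
    simp
  ract_id x y := by
    rw [← MonoidalCategory.whiskerLeft_comp_assoc, g.map_id, e_comp_id]
  ract_comp x y y' y'' := by
    rw [← MonoidalCategory.whiskerLeft_comp_assoc, g.map_comp,
      MonoidalCategory.whiskerLeft_comp_assoc,
      ← e_assoc, comp_whiskerRight_assoc, ← whisker_exchange_assoc, MonoidalCategory.tensorHom_def]
    simp
  lact_ract x' x y y' := by
    simp only [comp_whiskerRight, MonoidalCategory.whiskerLeft_comp, Category.assoc]
    rw [← whisker_exchange_assoc, ← e_assoc', whisker_exchange_assoc, whisker_exchange_assoc]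
    simp

/-- The representable `V`-distributor `X(1, g)`. -/
abbrev representable {D X : VCat.{w, v, u} V} (g : EnrichedFunctor V D X) : Distributor X D :=
  homDist (EnrichedFunctor.id V X) g

variable (V) in
/-- Composable chains `p₁, …, pₙ` (`n ≥ 0`) of `V`-distributors. -/
inductive Chain : VCat.{w, v, u} V → VCat.{w, v, u} V → Type (max (u + 1) v w)
  | nil (C : VCat.{w, v, u} V) : Chain C C
  | cons {C D D' : VCat.{w, v, u} V} (p : Distributor C D) (P : Chain D D') : Chain C D'

/-- Families of morphisms
`W z₀ ⊗ p₁(z₀, z₁) ⊗ ⋯ ⊗ pₙ(zₙ₋₁, zₙ) ⟶ Z zₙ`, indexed by all `z₀, …, zₙ`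
(the tensor product is bracketed to the left). -/
def Family : ∀ {C D : VCat.{w, v, u} V}, Chain V C D → (C → V) → (D → V) →
    Type (max u w)
  | C, _, .nil _, W, Z => ∀ z : C, W z ⟶ Z z
  | C, _, .cons p P, W, Z => ∀ z : C, Family P (fun z' => W z ⊗ p.obj z z') Z

namespace Family

/-- Precomposition in the leftmost variable. -/
def precomp : ∀ {C D : VCat.{w, v, u} V} (P : Chain V C D) {W' W : C → V} {Z : D → V},
    (∀ z, W' z ⟶ W z) → Family P W Z → Family P W' Z
  | _, _, .nil _, _, _, _, f, φ => fun z => f z ≫ φ z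
  | _, _, .cons p P, _, _, _, f, φ =>
      fun z => precomp P (fun z' => f z ▷ p.obj z z') (φ z)

/-- Postcomposition. -/
def postcomp : ∀ {C D : VCat.{w, v, u} V} (P : Chain V C D) {W : C → V} {Z Z' : D → V},
    (∀ z, Z z ⟶ Z' z) → Family P W Z → Family P W Z'
  | _, _, .nil _, _, _, _, g, φ => fun z => φ z ≫ g z
  | _, _, .cons _ P, _, _, _, g, φ => fun z => postcomp P g (φ z)

/-- Tensoring every member of a family on the left with an object `v`. -/
def whiskerLeft : ∀ {C D : VCat.{w, v, u} V} (P : Chain V C D) (v : V) {W : C → V}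
    {Z : D → V}, Family P W Z → Family P (fun z => v ⊗ W z) (fun z => v ⊗ Z z)
  | _, _, .nil _, v, _, _, φ => fun z => v ◁ φ z
  | _, _, .cons p P, v, W, _, φ =>
      fun z => precomp P (fun z' => (α_ v (W z) (p.obj z z')).hom) (whiskerLeft P v (φ z))

/-- `V`-naturality of a family in `z₀, …, zₙ`, where `W` and `Z` carry right actions: the two
actions on each of `z₀, …, zₙ₋₁` (from the factors to its left and to its right) agree after
composing with the family, and the family commutes with the right actions on `zₙ`. -/
def Natural : ∀ {C D : VCat.{w, v, u} V} (P : Chain V C D) {W : C → V} {Z : D → V},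
    (∀ z z' : C, W z ⊗ (z ⟶[V] z') ⟶ W z') → (∀ z z' : D, Z z ⊗ (z ⟶[V] z') ⟶ Z z') →
    Family P W Z → Prop
  | C, _, .nil _, _, _, aW, aZ, φ =>
      ∀ z z' : C, aW z z' ≫ φ z' = φ z ▷ (z ⟶[V] z') ≫ aZ z z'
  | C, _, .cons p P, W, _, aW, aZ, φ =>
      (∀ z z' : C,
        precomp P (fun y => aW z z' ▷ p.obj z' y) (φ z') =
          precomp P (fun y => (α_ (W z) (z ⟶[V] z') (p.obj z' y)).hom ≫ W z ◁ p.lact z z' y)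
            (φ z)) ∧
      ∀ z : C, Natural P (fun y y' => (α_ (W z) (p.obj z y) (y ⟶[V] y')).hom ≫ W z ◁ p.ract z y y')
        aZ (φ z)

end Family

/-- A `V`-form `p, p₁, …, pₙ ⇒ q` (with identity tight-cells on both sides), where `P` is the
chain `p₁, …, pₙ`. -/
structure VForm {C D D' : VCat.{w, v, u} V} (p : Distributor C D) (P : Chain V D D')
    (q : Distributor C D') where
  app : ∀ x : C, Family P (p.obj x) (q.obj x)
  natural_left : ∀ x' x : C,
    Family.precomp P (p.lact x' x) (app x') =
      Family.postcomp P (q.lact x' x) (Family.whiskerLeft P (x' ⟶[V] x) (app x))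
  natural_right : ∀ x : C, Family.Natural P (p.ract x) (q.ract x) (app x)

/-- A monad relative to a `V`-functor `j`: a `V`-functor `t`, a `V`-form `† : E(j, t) ⇒ E(t, t)`
and a `V`-natural transformation `η : j ⇒ t`, subject to unit and associativity laws. -/
structure RelativeMonad {A E : VCat.{w, v, u} V} (j : EnrichedFunctor V A E) where
  t : EnrichedFunctor V A E
  dag : ∀ x y : A, (j.obj x ⟶[V] t.obj y) ⟶ (t.obj x ⟶[V] t.obj y)
  dag_natural_left : ∀ x y z : A,
    (j.map x y ▷ (j.obj y ⟶[V] t.obj z) ≫ eComp V _ _ _) ≫ dag x z =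
      (x ⟶[V] y) ◁ dag y z ≫ t.map x y ▷ (t.obj y ⟶[V] t.obj z) ≫ eComp V _ _ _
  dag_natural_right : ∀ x y z : A,
    ((j.obj x ⟶[V] t.obj y) ◁ t.map y z ≫ eComp V _ _ _) ≫ dag x z =
      dag x y ▷ (y ⟶[V] z) ≫ (t.obj x ⟶[V] t.obj y) ◁ t.map y z ≫ eComp V _ _ _
  η : ∀ x : A, 𝟙_ V ⟶ (j.obj x ⟶[V] t.obj x)
  η_natural : ∀ x y : A,
    (λ_ (x ⟶[V] y)).inv ≫ η x ▷ (x ⟶[V] y) ≫ (j.obj x ⟶[V] t.obj x) ◁ t.map x y ≫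
        eComp V _ _ _ =
      (ρ_ (x ⟶[V] y)).inv ≫ (x ⟶[V] y) ◁ η y ≫ j.map x y ▷ (j.obj y ⟶[V] t.obj y) ≫
        eComp V _ _ _
  dag_unit : ∀ x y : A,
    dag x y ≫ (λ_ (t.obj x ⟶[V] t.obj y)).inv ≫ η x ▷ (t.obj x ⟶[V] t.obj y) ≫ eComp V _ _ _ =
      𝟙 (j.obj x ⟶[V] t.obj y)
  unit_dag : ∀ x : A, η x ≫ dag x x = eId V (t.obj x)
  dag_dag : ∀ x y z : A,
    (dag x y ⊗ₘ dag y z) ≫ eComp V (t.obj x) (t.obj y) (t.obj z) =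
      (j.obj x ⟶[V] t.obj y) ◁ dag y z ≫ eComp V (j.obj x) (t.obj y) (t.obj z) ≫ dag x z

section Algebras

variable {A E : VCat.{w, v, u} V} {j : EnrichedFunctor V A E}

/-- An algebra for `T` with domain the `V`-category `D`: a `V`-functor `e : D ⟶ E` and a `V`-form
`E(j, e) ⇒ E(t, e)`, subject to unit and associativity laws. -/
structure TAlgebra (T : RelativeMonad j) (D : VCat.{w, v, u} V) where
  e : EnrichedFunctor V D E
  ext : ∀ (x : A) (z : D), (j.obj x ⟶[V] e.obj z) ⟶ (T.t.obj x ⟶[V] e.obj z)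
  natural_left : ∀ (x y : A) (z : D),
    (j.map x y ▷ (j.obj y ⟶[V] e.obj z) ≫ eComp V _ _ _) ≫ ext x z =
      (x ⟶[V] y) ◁ ext y z ≫ T.t.map x y ▷ (T.t.obj y ⟶[V] e.obj z) ≫ eComp V _ _ _
  natural_right : ∀ (x : A) (y z : D),
    ((j.obj x ⟶[V] e.obj y) ◁ e.map y z ≫ eComp V _ _ _) ≫ ext x z =
      ext x y ▷ (y ⟶[V] z) ≫ (T.t.obj x ⟶[V] e.obj y) ◁ e.map y z ≫ eComp V _ _ _
  unit : ∀ (x : A) (z : D),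
    ext x z ≫ (λ_ (T.t.obj x ⟶[V] e.obj z)).inv ≫ T.η x ▷ (T.t.obj x ⟶[V] e.obj z) ≫
      eComp V _ _ _ = 𝟙 (j.obj x ⟶[V] e.obj z)
  assoc : ∀ (x y : A) (z : D),
    (T.dag x y ⊗ₘ ext y z) ≫ eComp V (T.t.obj x) (T.t.obj y) (e.obj z) =
      (j.obj x ⟶[V] T.t.obj y) ◁ ext y z ≫ eComp V (j.obj x) (T.t.obj y) (e.obj z) ≫ ext x z

/-- Precomposition of a `T`-algebra with domain `D` with a `V`-functor `F : D' ⟶ D`. -/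
def TAlgebra.pullback {T : RelativeMonad j} {D D' : VCat.{w, v, u} V} (X : TAlgebra T D)
    (F : EnrichedFunctor V D' D) : TAlgebra T D' where
  e := F.comp V X.e
  ext x z := X.ext x (F.obj z)
  natural_left x y z := X.natural_left x y (F.obj z)
  natural_right x y z := by
    have h := X.natural_right x (F.obj y) (F.obj z)
    change ((j.obj x ⟶[V] X.e.obj (F.obj y)) ◁ (F.map y z ≫ X.e.map (F.obj y) (F.obj z)) ≫
      eComp V _ _ _) ≫ X.ext x (F.obj z) = X.ext x (F.obj y) ▷ (y ⟶[V] z) ≫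
        (T.t.obj x ⟶[V] X.e.obj (F.obj y)) ◁ (F.map y z ≫ X.e.map (F.obj y) (F.obj z)) ≫
          eComp V _ _ _
    simp only [MonoidalCategory.whiskerLeft_comp, Category.assoc] at h ⊢
    rw [h, whisker_exchange_assoc]
  unit x z := X.unit x (F.obj z)
  assoc x y z := X.assoc x y (F.obj z)

/-- The condition for a `V`-form `ε : E(1, e), p₁, …, pₙ ⇒ E(1, e')` to be a
`(p₁, …, pₙ)`-graded morphism of `T`-algebras. -/
def IsGradedMorphism {T : RelativeMonad j} {D D' : VCat.{w, v, u} V} (X : TAlgebra T D)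
    (X' : TAlgebra T D') (P : Chain V D D') (ε : VForm (representable X.e) P (representable X'.e)) : Prop :=
  ∀ x : A,
    Family.precomp P (W' := (homDist j X.e).obj x) (W := (homDist T.t X.e).obj x)
        (X.ext x) (ε.app (T.t.obj x)) =
      Family.postcomp P (Z := (homDist j X'.e).obj x) (Z' := (homDist T.t X'.e).obj x)
        (X'.ext x) (ε.app (j.obj x))

/-- `ε` is the 2-cell `E(1, u), α`: the pasting of `α` with the `V`-functor `u : C ⟶ E`. Both
sides are 2-cells `E(1, u), C(1, F), p₁, …, pₙ ⇒ E(1, F' ⋙ u)`; on the left, `E(1, F ⋙ u)` is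
the composite of `E(1, u)` and `C(1, F)` via the canonical opcartesian 2-cell. -/
def IsPasting {C D D' : VCat.{w, v, u} V} (u : EnrichedFunctor V C E)
    (F : EnrichedFunctor V D C) (F' : EnrichedFunctor V D' C) (P : Chain V D D')
    (α : VForm (representable F) P (representable F')) (ε : VForm (representable (F.comp V u)) P (representable (F'.comp V u))) :
    Prop :=
  ∀ (x : E) (y : C),
    Family.precomp P
        (W' := fun z => (x ⟶[V] u.obj y) ⊗ (y ⟶[V] F.obj z))
        (W := (representable (F.comp V u)).obj x)
        (fun z => (x ⟶[V] u.obj y) ◁ u.map y (F.obj z) ≫ eComp V x (u.obj y) (u.obj (F.obj z)))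
        (ε.app x) =
      Family.postcomp P
        (Z := fun z => (x ⟶[V] u.obj y) ⊗ (y ⟶[V] F'.obj z))
        (Z' := (representable (F'.comp V u)).obj x)
        (fun z => (x ⟶[V] u.obj y) ◁ u.map y (F'.obj z) ≫ eComp V x (u.obj y) (u.obj (F'.obj z)))
        (Family.whiskerLeft P (x ⟶[V] u.obj y) (α.app y))

/-- The `T`-algebra `U` is an algebra object for `T`. By `lift`, every `T`-algebra is `U.pullback F`
for a unique `F`, so that `lift_hom` concerns graded morphisms between arbitrary `T`-algebras. -/
structure IsAlgebraObject {T : RelativeMonad j} {C : VCat.{w, v, u} V}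
    (U : TAlgebra T C) : Prop where
  lift : ∀ (D : VCat.{w, v, u} V) (X : TAlgebra T D),
    ∃! F : EnrichedFunctor V D C, U.pullback F = X
  lift_hom : ∀ (D D' : VCat.{w, v, u} V) (P : Chain V D D')
    (F : EnrichedFunctor V D C) (F' : EnrichedFunctor V D' C)
    (ε : VForm (representable (F.comp V U.e)) P (representable (F'.comp V U.e))),
    IsGradedMorphism (U.pullback F) (U.pullback F') P ε →
      ∃! α : VForm (representable F) P (representable F'), IsPasting U.e F F' P α ε

/-- `T` admits an algebra object. -/
def AdmitsAlgebraObject (T : RelativeMonad j) : Prop :=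
  ∃ (C : VCat.{w, v, u} V) (U : TAlgebra T C), IsAlgebraObject U

/-- An Eilenberg–Moore algebra for `T`. -/
structure EMAlgebra (T : RelativeMonad j) where
  carrier : E
  ext : ∀ x : A, (j.obj x ⟶[V] carrier) ⟶ (T.t.obj x ⟶[V] carrier)
  unit : ∀ x : A, ext x ≫ (λ_ (T.t.obj x ⟶[V] carrier)).inv ≫
      T.η x ▷ (T.t.obj x ⟶[V] carrier) ≫ eComp V _ _ _ =
    𝟙 (j.obj x ⟶[V] carrier)
  assoc : ∀ x y : A,
    (T.dag x y ⊗ₘ ext y) ≫ eComp V (T.t.obj x) (T.t.obj y) carrier =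
      (j.obj x ⟶[V] T.t.obj y) ◁ ext y ≫ eComp V (j.obj x) (T.t.obj y) carrier ≫ ext x

/-- `h : v ⟶ E(e, e')` is a `v`-graded homomorphism of Eilenberg–Moore algebras. -/
def IsGradedHom {T : RelativeMonad j} (a b : EMAlgebra T) {v : V}
    (h : v ⟶ (a.carrier ⟶[V] b.carrier)) : Prop :=
  ∀ x : A,
    a.ext x ▷ v ≫ (T.t.obj x ⟶[V] a.carrier) ◁ h ≫ eComp V _ _ _ =
      (j.obj x ⟶[V] a.carrier) ◁ h ≫ eComp V _ _ _ ≫ b.ext x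

/-- A universal graded homomorphism between Eilenberg–Moore algebras. -/
structure UniversalGradedHom {T : RelativeMonad j} (a b : EMAlgebra T) where
  obj : V
  hom : obj ⟶ (a.carrier ⟶[V] b.carrier)
  isGradedHom : IsGradedHom a b hom
  existsUnique : ∀ (v : V) (h : v ⟶ (a.carrier ⟶[V] b.carrier)), IsGradedHom a b h →
    ∃! k : v ⟶ obj, k ≫ hom = h

namespace UniversalGradedHom

variable {T : RelativeMonad j} {a b : EMAlgebra T}

def lift (𝒰 : UniversalGradedHom a b) {v : V} (h : v ⟶ (a.carrier ⟶[V] b.carrier))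
    (hh : IsGradedHom a b h) : v ⟶ 𝒰.obj :=
  (𝒰.existsUnique v h hh).choose

theorem lift_hom (𝒰 : UniversalGradedHom a b) {v : V} (h : v ⟶ (a.carrier ⟶[V] b.carrier))
    (hh : IsGradedHom a b h) : 𝒰.lift h hh ≫ 𝒰.hom = h :=
  (𝒰.existsUnique v h hh).choose_spec.1

end UniversalGradedHom

theorem IsGradedHom.precomp {T : RelativeMonad j} {a b : EMAlgebra T} {v v' : V} (k : v' ⟶ v)
    {h : v ⟶ (a.carrier ⟶[V] b.carrier)} (hh : IsGradedHom a b h) : IsGradedHom a b (k ≫ h) := by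
  intro x
  have := hh x
  simp only [MonoidalCategory.whiskerLeft_comp, Category.assoc]
  rw [← this, whisker_exchange_assoc]

theorem UniversalGradedHom.hom_ext {T : RelativeMonad j} {a b : EMAlgebra T}
    (𝒰 : UniversalGradedHom a b) {v : V} {k k' : v ⟶ 𝒰.obj} (h : k ≫ 𝒰.hom = k' ≫ 𝒰.hom) :
    k = k' :=
  (𝒰.existsUnique v _ (𝒰.isGradedHom.precomp k')).unique h rfl

theorem isGradedHom_id {T : RelativeMonad j} (a : EMAlgebra T) :
    IsGradedHom a a (eId V a.carrier) := by
  intro x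
  have h1 := e_comp_id V (T.t.obj x) a.carrier
  have h2 := e_comp_id V (j.obj x) a.carrier
  rw [Iso.inv_comp_eq, Category.comp_id] at h1 h2
  rw [h1, reassoc_of% h2]
  simp

theorem isGradedHom_comp {T : RelativeMonad j} {a b c : EMAlgebra T} {v v' : V}
    {h : v ⟶ (a.carrier ⟶[V] b.carrier)} {h' : v' ⟶ (b.carrier ⟶[V] c.carrier)}
    (hh : IsGradedHom a b h) (hh' : IsGradedHom b c h') :
    IsGradedHom a c ((h ⊗ₘ h') ≫ eComp V _ _ _) := by
  intro x
  have H : ∀ y : E, (y ⟶[V] a.carrier) ◁ ((h ⊗ₘ h') ≫ eComp V _ _ _) ≫ eComp V _ _ _ =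
      (α_ _ _ _).inv ≫ ((y ⟶[V] a.carrier) ◁ h ≫ eComp V _ _ _) ▷ v' ≫
        (y ⟶[V] b.carrier) ◁ h' ≫ eComp V _ _ _ := by
    intro y
    rw [MonoidalCategory.whiskerLeft_comp, Category.assoc, ← e_assoc]
    simp only [comp_whiskerRight, Category.assoc, MonoidalCategory.tensorHom_def, MonoidalCategory.whiskerLeft_comp]
    rw [← whisker_exchange_assoc]
    simp
  rw [H, reassoc_of% (H (j.obj x)), ← hh' x]
  have := congrArg (fun f => f ▷ v') (hh x)
  simp only [comp_whiskerRight, Category.assoc] at this ⊢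
  rw [← reassoc_of% this]
  simp

end Algebras

section EilenbergMoore

variable {A E : VCat.{w, v, max u w} V} {j : EnrichedFunctor V A E} {T : RelativeMonad j}

/-- The `V`-category of Eilenberg–Moore algebras with hom-objects the (chosen) domains of universal
graded homomorphisms. -/
def EMCat (𝒰 : ∀ a b : EMAlgebra T, UniversalGradedHom a b) :
    VCat.{w, v, max u w} V where
  Obj := EMAlgebra T
  str :=
    { Hom a b := (𝒰 a b).obj
      id a := (𝒰 a a).lift (eId V a.carrier) (isGradedHom_id a)
      comp a b c := (𝒰 a c).lift (((𝒰 a b).hom ⊗ₘ (𝒰 b c).hom) ≫ eComp V _ _ _)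
        (isGradedHom_comp (𝒰 a b).isGradedHom (𝒰 b c).isGradedHom)
      id_comp a b := by
        apply (𝒰 a b).hom_ext
        simp only [Category.assoc, UniversalGradedHom.lift_hom, Category.id_comp]
        rw [MonoidalCategory.tensorHom_def, Category.assoc, ← comp_whiskerRight_assoc,
          UniversalGradedHom.lift_hom, ← whisker_exchange_assoc,
          ← leftUnitor_inv_naturality_assoc, e_id_comp, Category.comp_id]
      comp_id a b := by
        apply (𝒰 a b).hom_ext
        simp only [Category.assoc, UniversalGradedHom.lift_hom, Category.id_comp]
        rw [MonoidalCategory.tensorHom_def', Category.assoc,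
          ← MonoidalCategory.whiskerLeft_comp_assoc,
          UniversalGradedHom.lift_hom, whisker_exchange_assoc,
          ← rightUnitor_inv_naturality_assoc, e_comp_id, Category.comp_id]
      assoc a b c d := by
        apply (𝒰 a d).hom_ext
        simp only [Category.assoc, UniversalGradedHom.lift_hom]
        rw [MonoidalCategory.tensorHom_def (𝒰 a c).hom, Category.assoc, ← comp_whiskerRight_assoc,
          UniversalGradedHom.lift_hom, MonoidalCategory.tensorHom_def' (𝒰 a b).hom (𝒰 b d).hom,
          Category.assoc, ← MonoidalCategory.whiskerLeft_comp_assoc, UniversalGradedHom.lift_hom,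
          MonoidalCategory.whiskerLeft_comp_assoc, whisker_exchange_assoc, ← e_assoc,
          comp_whiskerRight_assoc, ← whisker_exchange_assoc]
        simp only [MonoidalCategory.tensorHom_def, comp_whiskerRight, Category.assoc,
          MonoidalCategory.whiskerLeft_comp, whisker_assoc, whisker_exchange_assoc, e_assoc,
          associator_naturality_left_assoc, Iso.inv_hom_id_assoc]
        rw [← e_assoc, associator_inv_naturality_right_assoc, whisker_exchange_assoc] }

/-- The forgetful `V`-functor `u_T` from the Eilenberg–Moore `V`-category. -/
def EMForget (𝒰 : ∀ a b : EMAlgebra T, UniversalGradedHom a b) :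
    EnrichedFunctor V (EMCat 𝒰) E where
  obj a := a.carrier
  map a b := (𝒰 a b).hom
  map_id a := (𝒰 a a).lift_hom _ (isGradedHom_id a)
  map_comp a b c := (𝒰 a c).lift_hom _ (isGradedHom_comp (𝒰 a b).isGradedHom (𝒰 b c).isGradedHom)

/-- The extension operator of an Eilenberg–Moore algebra is `V`-natural. -/
theorem EMAlgebra.ext_natural (a : EMAlgebra T) (x' x : A) :
    (j.map x' x ▷ (j.obj x ⟶[V] a.carrier) ≫ eComp V _ _ _) ≫ a.ext x' =
      (x' ⟶[V] x) ◁ a.ext x ≫ T.t.map x' x ▷ (T.t.obj x ⟶[V] a.carrier) ≫ eComp V _ _ _ := by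
  have ht : T.t.map x' x = (ρ_ _).inv ≫ (x' ⟶[V] x) ◁ T.η x ≫
      (j.map x' x ▷ _ ≫ eComp V _ _ _) ≫ T.dag x' x := by
    rw [T.dag_natural_left, ← MonoidalCategory.whiskerLeft_comp_assoc, T.unit_dag,
      whisker_exchange_assoc, ← rightUnitor_inv_naturality_assoc, e_comp_id, Category.comp_id]
  have hk : ∀ k : (x' ⟶[V] x) ⟶ (j.obj x' ⟶[V] T.t.obj x),
      (x' ⟶[V] x) ◁ a.ext x ≫ (k ≫ T.dag x' x) ▷ _ ≫ eComp V _ _ _ =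
        k ▷ _ ≫ _ ◁ a.ext x ≫ eComp V _ _ _ ≫ a.ext x' := by
    intro k
    rw [← a.assoc, MonoidalCategory.tensorHom_def', comp_whiskerRight, Category.assoc,
      Category.assoc, whisker_exchange_assoc]
  have ht' : T.t.map x' x = ((ρ_ _).inv ≫ (x' ⟶[V] x) ◁ T.η x ≫
      j.map x' x ▷ _ ≫ eComp V _ _ _) ≫ T.dag x' x := by
    rw [ht]; simp only [Category.assoc]
  rw [ht', hk, ← whisker_exchange_assoc]
  simp only [comp_whiskerRight, Category.assoc]
  rw [← e_assoc'_assoc, associator_naturality_left_assoc, associator_naturality_middle_assoc,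
    ← whisker_exchange_assoc]
  have hu' := congrArg (fun f => (x' ⟶[V] x) ◁ f) (a.unit x)
  simp only [MonoidalCategory.whiskerLeft_comp, MonoidalCategory.whiskerLeft_id] at hu'
  have ht3 : (ρ_ (x' ⟶[V] x)).inv ▷ (T.t.obj x ⟶[V] a.carrier) ≫ (α_ _ _ _).hom =
    (x' ⟶[V] x) ◁ (λ_ _).inv := by simp
  rw [reassoc_of% ht3, reassoc_of% hu']

/-- The Eilenberg–Moore `V`-category as a `T`-algebra. -/
def EMTAlgebra (𝒰 : ∀ a b : EMAlgebra T, UniversalGradedHom a b) : TAlgebra T (EMCat 𝒰) where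
  e := EMForget 𝒰
  ext x a := a.ext x
  natural_left x y a := a.ext_natural x y
  natural_right x a b := (Category.assoc _ _ _).trans ((𝒰 a b).isGradedHom x).symm
  unit x a := a.unit x
  assoc x y a := a.assoc x y

end EilenbergMoore

/-- A `V`-presheaf on a `V`-category `Z`. -/
structure VPresheaf (Z : VCat.{w, v, u} V) where
  obj : Z → V
  act : ∀ z' z : Z, (z' ⟶[V] z) ⊗ obj z ⟶ obj z'
  act_id : ∀ z : Z, eId V z ▷ obj z ≫ act z z = (λ_ (obj z)).hom
  act_comp : ∀ z'' z' z : Z,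
    eComp V z'' z' z ▷ obj z ≫ act z'' z =
      (α_ _ _ _).hom ≫ (z'' ⟶[V] z') ◁ act z' z ≫ act z'' z'

/-- `V`-naturality of a family `p(z) ⊗ v ⟶ q(z)`. -/
def VPresheaf.IsNatural {Z : VCat.{w, v, u} V} (p q : VPresheaf Z) {v : V}
    (φ : ∀ z, p.obj z ⊗ v ⟶ q.obj z) : Prop :=
  ∀ z' z : Z, p.act z' z ▷ v ≫ φ z' =
    (α_ _ _ _).hom ≫ (z' ⟶[V] z) ◁ φ z ≫ q.act z' z

/-- The object of `V`-natural transformations from `p` to `q` exists. -/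
def VPresheaf.HasNatObj {Z : VCat.{w, v, u} V} (p q : VPresheaf Z) : Prop :=
  ∃ (N : V) (ϖ : ∀ z, p.obj z ⊗ N ⟶ q.obj z), p.IsNatural q ϖ ∧
    ∀ (v : V) (φ : ∀ z, p.obj z ⊗ v ⟶ q.obj z), p.IsNatural q φ →
      ∃! k : v ⟶ N, ∀ z, p.obj z ◁ k ≫ ϖ z = φ z

/-- The nerve `E(j-, e)` of `j` at `e`. -/
def nervePresheaf {A E : VCat.{w, v, u} V} (j : EnrichedFunctor V A E) (e : E) : VPresheaf A where
  obj x := j.obj x ⟶[V] e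
  act x' x := j.map x' x ▷ _ ≫ eComp V _ _ _
  act_id x := by
    rw [← comp_whiskerRight_assoc, j.map_id]
    have := e_id_comp V (j.obj x) e
    rwa [Iso.inv_comp_eq, Category.comp_id] at this
  act_comp x'' x' x := by
    rw [← comp_whiskerRight_assoc, j.map_comp, comp_whiskerRight_assoc,
      ← e_assoc', MonoidalCategory.whiskerLeft_comp_assoc, whisker_exchange_assoc,
      MonoidalCategory.tensorHom_def']
    simp

end VCat

end

end EnrichedRelMonad

open EnrichedRelMonad

/-! Everything turns on `TAlgebra.IsUniversal`: the hom-morphisms `C(c, c') ⟶ E(uc, uc')` of a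
`T`-algebra are universal graded homomorphisms, that is, monomorphisms through which all graded
homomorphisms factor.

From universality to algebra objects. The algebra on `EMCat` is universal by construction. A
`T`-algebra on `D` sends each object of `D` to an Eilenberg–Moore algebra, and right naturality of
its extension operator says that its hom-morphisms are graded homomorphisms. They therefore lift,
giving the unique comparison functor. For a graded morphism `ε`, evaluation at `uc` followed by
restriction along `C(c, Fz) ⟶ E(uc, uFz)` gives a family whose members are all graded homomorphisms
(`Family.all_isGradedHom_restrict`). It factors through the monomorphisms `C(c, F'z) ⟶ E(uc, uF'z)`;
the factorisation is the required form `α`, naturality being reflected by monomorphisms. By Yoneda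
no other form is possible (`IsPasting.postcomp_app`).

From algebra objects to universality. Testing against the unit `V`-category suffices: `T`-algebras
on it come from Eilenberg–Moore algebras, whose extension operators are automatically natural, and a
`v`-graded homomorphism is a morphism graded by the constant distributor at `v`
(`IsAlgebraObject.isUniversal`, `IsAlgebraObject.exists_at_eq`).

For the sufficient condition, being a graded homomorphism is an equation between two morphisms into
an object of natural transformations, so an equaliser is universal. -/

namespace EnrichedRelMonad

/-! ### Calculus of families indexed by chains of distributors -/

section Families

variable {V : Type v} [Category.{w} V] [MonoidalCategory V]

namespace Family

variable {C D : VCat.{w, v, u} V}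

theorem precomp_precomp (P : Chain V C D) {W'' W' W : C → V} {Z : D → V}
    (f : ∀ z, W'' z ⟶ W' z) (g : ∀ z, W' z ⟶ W z) (φ : Family P W Z) :
    precomp P f (precomp P g φ) = precomp P (fun z => f z ≫ g z) φ := by
  induction P with
  | nil => funext z; exact (Category.assoc _ _ _).symm
  | cons p P ih =>
    funext z
    refine (ih _ _ (φ z)).trans ?_
    change _ = precomp P (fun z' => (f z ≫ g z) ▷ p.obj z z') (φ z)
    simp only [comp_whiskerRight]

theorem precomp_id (P : Chain V C D) {W : C → V} {Z : D → V} (φ : Family P W Z) :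
    precomp P (fun z => 𝟙 (W z)) φ = φ := by
  induction P with
  | nil => funext z; exact Category.id_comp _
  | cons p P ih =>
    funext z
    change precomp P (fun z' => 𝟙 _ ▷ p.obj z z') (φ z) = _
    simp only [id_whiskerRight]
    exact ih (φ z)

theorem precomp_injective (P : Chain V C D) {W' W : C → V} {Z : D → V}
    (f : ∀ z, W' z ≅ W z) {φ ψ : Family P W Z}
    (h : precomp P (fun z => (f z).hom) φ = precomp P (fun z => (f z).hom) ψ) : φ = ψ := by
  have := congrArg (precomp P (fun z => (f z).inv)) h
  simpa only [precomp_precomp, Iso.inv_hom_id, precomp_id] using this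

theorem postcomp_postcomp (P : Chain V C D) {W : C → V} {Z Z' Z'' : D → V}
    (f : ∀ z, Z z ⟶ Z' z) (g : ∀ z, Z' z ⟶ Z'' z) (φ : Family P W Z) :
    postcomp P g (postcomp P f φ) = postcomp P (fun z => f z ≫ g z) φ := by
  induction P with
  | nil => funext z; exact Category.assoc _ _ _
  | cons p P ih => funext z; exact ih _ _ (φ z)

theorem postcomp_precomp (P : Chain V C D) {W' W : C → V} {Z Z' : D → V}
    (f : ∀ z, W' z ⟶ W z) (g : ∀ z, Z z ⟶ Z' z) (φ : Family P W Z) :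
    postcomp P g (precomp P f φ) = precomp P f (postcomp P g φ) := by
  induction P with
  | nil => funext z; exact Category.assoc _ _ _
  | cons p P ih => funext z; exact ih _ _ (φ z)

theorem postcomp_injective (P : Chain V C D) {W : C → V} {Z Z' : D → V}
    (g : ∀ z, Z z ⟶ Z' z) [∀ z, Mono (g z)] {φ ψ : Family P W Z}
    (h : postcomp P g φ = postcomp P g ψ) : φ = ψ := by
  induction P with
  | nil => funext z; exact (cancel_mono (g z)).1 (congrFun h z)
  | cons p P ih => funext z; exact ih g (congrFun h z)

theorem whiskerLeft_precomp (P : Chain V C D) (x : V) {W' W : C → V} {Z : D → V}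
    (f : ∀ z, W' z ⟶ W z) (φ : Family P W Z) :
    whiskerLeft P x (precomp P f φ) = precomp P (fun z => x ◁ f z) (whiskerLeft P x φ) := by
  induction P with
  | nil => funext z; exact MonoidalCategory.whiskerLeft_comp _ _ _
  | cons p P ih =>
    funext z
    refine (congrArg (precomp P _) (ih _ (φ z))).trans ?_
    refine (precomp_precomp P _ _ _).trans ?_
    refine Eq.trans ?_ (precomp_precomp P _ _ _).symm
    simp

theorem whiskerLeft_postcomp (P : Chain V C D) (x : V) {W : C → V} {Z Z' : D → V}
    (g : ∀ z, Z z ⟶ Z' z) (φ : Family P W Z) :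
    whiskerLeft P x (postcomp P g φ) = postcomp P (fun z => x ◁ g z) (whiskerLeft P x φ) := by
  induction P with
  | nil => funext z; exact MonoidalCategory.whiskerLeft_comp _ _ _
  | cons p P ih =>
    funext z
    exact (congrArg (precomp P _) (ih _ (φ z))).trans (postcomp_precomp P _ _ _).symm

/-- The interchange law for families; with its unit counterpart below it yields the Yoneda argument.
-/
theorem precomp_whiskerRight_whiskerLeft (P : Chain V C D) {x y : V} (f : x ⟶ y) {W : C → V}
    {Z : D → V} (φ : Family P W Z) :
    precomp P (fun z => f ▷ W z) (whiskerLeft P y φ) =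
      postcomp P (fun z => f ▷ Z z) (whiskerLeft P x φ) := by
  induction P with
  | nil => funext z; exact (whisker_exchange _ _).symm
  | cons p P ih =>
    funext z
    refine (precomp_precomp P _ _ _).trans ?_
    refine Eq.trans ?_ (postcomp_precomp P _ _ _).symm
    rw [← ih (φ z), precomp_precomp]
    simp

theorem precomp_leftUnitor_whiskerLeft (P : Chain V C D) {W : C → V} {Z : D → V}
    (φ : Family P W Z) :
    precomp P (fun z => (λ_ (W z)).inv) (whiskerLeft P (𝟙_ V) φ) =
      postcomp P (fun z => (λ_ (Z z)).inv) φ := by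
  induction P with
  | nil => funext z; exact (leftUnitor_inv_naturality _).symm
  | cons p P ih =>
    funext z
    refine (precomp_precomp P _ _ _).trans ?_
    refine Eq.trans ?_ (ih (φ z))
    simp

/-- A predicate on morphisms into the members of `Z` holds for all the members of a family. -/
def All : ∀ {C D : VCat.{w, v, u} V} (P : Chain V C D) {W : C → V} {Z : D → V},
    (∀ (z : D) (x : V), (x ⟶ Z z) → Prop) → Family P W Z → Prop
  | C, _, .nil _, _, _, R, φ => ∀ z : C, R z _ (φ z)
  | C, _, .cons _ P, _, _, R, φ => ∀ z : C, All P R (φ z)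

theorem All.exists_postcomp_eq (P : Chain V C D) {W : C → V} {Z Z' : D → V}
    (g : ∀ z, Z' z ⟶ Z z) {φ : Family P W Z}
    (h : All P (fun z _ k => ∃ l, l ≫ g z = k) φ) : ∃ ψ : Family P W Z', postcomp P g ψ = φ := by
  induction P with
  | nil => choose ψ hψ using h; exact ⟨ψ, funext hψ⟩
  | cons p P ih =>
    choose ψ hψ using fun z => ih g (h z)
    exact ⟨ψ, funext hψ⟩

theorem All.mono (P : Chain V C D) {W : C → V} {Z : D → V}
    {R S : ∀ (z : D) (x : V), (x ⟶ Z z) → Prop} (hRS : ∀ z x k, R z x k → S z x k)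
    {φ : Family P W Z} (h : All P R φ) : All P S φ := by
  induction P with
  | nil => exact fun z => hRS _ _ _ (h z)
  | cons p P ih => exact fun z => ih hRS (h z)

/-- Turns an identity between whole families into one equation for each member. With `f` an
extension operator and `c`, `d` built from composition, that equation is the graded homomorphism
condition. -/
theorem all_of_whiskerLeft (P : Chain V C D) {x y : V} (f : x ⟶ y) {W : C → V} {Z Z' : D → V}
    (c : ∀ z, y ⊗ Z z ⟶ Z' z) (d : ∀ z, x ⊗ Z z ⟶ Z' z) {φ : Family P W Z}
    (h : precomp P (fun z => f ▷ W z) (postcomp P c (whiskerLeft P y φ)) =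
      postcomp P d (whiskerLeft P x φ)) :
    All P (fun z a k => f ▷ a ≫ y ◁ k ≫ c z = x ◁ k ≫ d z) φ := by
  induction P with
  | nil => exact fun z => congrFun h z
  | cons p P ih =>
    intro z
    apply ih c d
    -- `whiskerLeft` inserts an associator for each distributor in the chain; being invertible, it
    -- can be cancelled.
    apply precomp_injective P (fun z' => α_ x (W z) (p.obj z z'))
    have hz : precomp P (fun z' => (f ▷ W z) ▷ p.obj z z')
        (postcomp P c (precomp P (fun z' => (α_ y (W z) (p.obj z z')).hom)
          (whiskerLeft P y (φ z)))) =
        postcomp P d (precomp P (fun z' => (α_ x (W z) (p.obj z z')).hom)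
          (whiskerLeft P x (φ z))) := congrFun h z
    rw [postcomp_precomp, postcomp_precomp, precomp_precomp] at hz
    rw [precomp_precomp, ← hz]
    simp

theorem all_forall (P : Chain V C D) {ι : Type*} {W : C → V} {Z : D → V}
    {R : ι → ∀ (z : D) (x : V), (x ⟶ Z z) → Prop} {φ : Family P W Z}
    (h : ∀ i, All P (R i) φ) : All P (fun z x k => ∀ i, R i z x k) φ := by
  induction P with
  | nil => exact fun z i => h i z
  | cons p P ih => exact fun z => ih fun i => h i z

theorem Natural.precomp (P : Chain V C D) {W' W : C → V} {Z : D → V}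
    {aW' : ∀ z z' : C, W' z ⊗ (z ⟶[V] z') ⟶ W' z'} {aW : ∀ z z' : C, W z ⊗ (z ⟶[V] z') ⟶ W z'}
    {aZ : ∀ z z' : D, Z z ⊗ (z ⟶[V] z') ⟶ Z z'} (f : ∀ z, W' z ⟶ W z)
    (hf : ∀ z z', aW' z z' ≫ f z' = f z ▷ (z ⟶[V] z') ≫ aW z z') {φ : Family P W Z}
    (h : Natural P aW aZ φ) : Natural P aW' aZ (precomp P f φ) := by
  induction P with
  | nil =>
    intro z z'
    change aW' z z' ≫ f z' ≫ φ z' = (f z ≫ φ z) ▷ _ ≫ aZ z z'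
    rw [← Category.assoc, hf, Category.assoc, h z z', comp_whiskerRight, Category.assoc]
  | cons p P ih =>
    refine ⟨fun z z' => ?_, fun z => ?_⟩
    · refine (precomp_precomp P _ _ _).trans ?_
      refine Eq.trans ?_ (precomp_precomp P _ _ _).symm
      have := congrArg (Family.precomp P (fun y => f z ▷ (z ⟶[V] z') ▷ p.obj z' y)) (h.1 z z')
      simp only [precomp_precomp] at this
      simp only [← comp_whiskerRight, hf]
      simp only [comp_whiskerRight] at this ⊢
      rw [this]
      simp [whisker_exchange]
    · refine ih (fun y => f z ▷ p.obj z y) (fun y y' => ?_) (h.2 z)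
      simp [whisker_exchange]

/-- Equivariant monomorphisms reflect naturality, so a factorisation through universal homomorphisms
needs no separate naturality argument. -/
theorem Natural.of_postcomp (P : Chain V C D) {W : C → V} {Z Z' : D → V}
    {aW : ∀ z z' : C, W z ⊗ (z ⟶[V] z') ⟶ W z'}
    {aZ : ∀ z z' : D, Z z ⊗ (z ⟶[V] z') ⟶ Z z'}
    {aZ' : ∀ z z' : D, Z' z ⊗ (z ⟶[V] z') ⟶ Z' z'} (g : ∀ z, Z z ⟶ Z' z) [∀ z, Mono (g z)]
    (hg : ∀ z z', aZ z z' ≫ g z' = g z ▷ (z ⟶[V] z') ≫ aZ' z z') {φ : Family P W Z}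
    (h : Natural P aW aZ' (postcomp P g φ)) : Natural P aW aZ φ := by
  induction P with
  | nil =>
    intro z z'
    have := h z z'
    change aW z z' ≫ φ z' ≫ g z' = (φ z ≫ g z) ▷ _ ≫ aZ' z z' at this
    rw [← cancel_mono (g z'), Category.assoc, this, Category.assoc, hg, comp_whiskerRight,
      Category.assoc]
  | cons p P ih =>
    refine ⟨fun z z' => postcomp_injective P g ?_, fun z => ih g hg (h.2 z)⟩
    rw [postcomp_precomp, postcomp_precomp]
    exact h.1 z z'

end Family

end Families

/-! ### Universal algebras and the lifting of graded morphisms -/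

section AlgebraObjects

variable {V : Type v} [Category.{w} V] [MonoidalCategory V]

theorem TAlgebra.ext_of_heq {A E D : VCat.{w, v, u} V} {j : EnrichedFunctor V A E}
    {T : RelativeMonad j} {X Y : TAlgebra T D} (he : X.e = Y.e) (hext : HEq X.ext Y.ext) :
    X = Y := by
  cases X; cases Y; cases he; cases hext; rfl

/-- The Eilenberg–Moore algebra at an object of the domain of a `T`-algebra. -/
abbrev TAlgebra.at {A E D : VCat.{w, v, u} V} {j : EnrichedFunctor V A E}
    {T : RelativeMonad j} (X : TAlgebra T D) (z : D) : EMAlgebra T where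
  carrier := X.e.obj z
  ext x := X.ext x z
  unit x := X.unit x z
  assoc x y := X.assoc x y z

/-- This is right naturality of the extension operator, read as a homomorphism condition. -/
theorem TAlgebra.isGradedHom_map {A E D : VCat.{w, v, u} V} {j : EnrichedFunctor V A E}
    {T : RelativeMonad j} (X : TAlgebra T D) (z z' : D) :
    IsGradedHom (X.at z) (X.at z') (X.e.map z z') := by
  intro x
  exact (X.natural_right x z z').symm.trans (Category.assoc _ _ _)

theorem EnrichedFunctor.ext_map {C D : VCat.{w, v, u} V} {F G : EnrichedFunctor V C D}
    (h : F.obj = G.obj) (h' : HEq F.map G.map) : F = G := by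
  cases F; cases G; cases h; cases h'; rfl

theorem VForm.ext_app {C D D' : VCat.{w, v, u} V} {p : Distributor C D} {P : Chain V D D'}
    {q : Distributor C D'} {φ ψ : VForm p P q} (h : φ.app = ψ.app) : φ = ψ := by
  cases φ; cases ψ; cases h; rfl

theorem UniversalGradedHom.mono_hom {A E : VCat.{w, v, u} V} {j : EnrichedFunctor V A E}
    {T : RelativeMonad j} {a b : EMAlgebra T} (𝒰 : UniversalGradedHom a b) : Mono 𝒰.hom :=
  ⟨fun _ _ h => 𝒰.hom_ext h⟩

/-- The Yoneda lemma for families: a family `φ` is recovered from the action of generalised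
elements. -/
theorem Family.yoneda {C D : VCat.{w, v, u} V} (P : Chain V C D) {W : C → V} {Z Z' : D → V}
    {x : V} (i : 𝟙_ V ⟶ x) (c : ∀ z, x ⊗ Z z ⟶ Z' z) (φ : Family P W Z) :
    Family.precomp P (fun z => (λ_ (W z)).inv ≫ i ▷ W z)
        (Family.postcomp P c (Family.whiskerLeft P x φ)) =
      Family.postcomp P (fun z => (λ_ (Z z)).inv ≫ i ▷ Z z ≫ c z) φ := by
  rw [← Family.precomp_precomp, ← Family.postcomp_precomp,
    Family.precomp_whiskerRight_whiskerLeft, Family.postcomp_postcomp,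
    ← Family.postcomp_precomp, Family.precomp_leftUnitor_whiskerLeft, Family.postcomp_postcomp]

theorem representable_lact {C D : VCat.{w, v, u} V} (f : EnrichedFunctor V D C) (x y : C)
    (z : D) : (representable f).lact x y z = eComp V x y (f.obj z) := by
  change 𝟙 (x ⟶[V] y) ▷ (y ⟶[V] f.obj z) ≫ eComp V x y (f.obj z) = _
  rw [id_whiskerRight, Category.id_comp]

/-- The left action in `V`-naturality of a `V`-form between representable `V`-distributors is
composition. -/
theorem VForm.natural_left_representable {E D D' : VCat.{w, v, u} V} {e : EnrichedFunctor V D E}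
    {e' : EnrichedFunctor V D' E} {P : Chain V D D'}
    (ε : VForm (representable e) P (representable e')) (x y : E) :
    Family.precomp P (W' := fun z => (x ⟶[V] y) ⊗ (y ⟶[V] e.obj z))
        (fun z => eComp V x y (e.obj z)) (ε.app x) =
    Family.postcomp P (Z := fun z => (x ⟶[V] y) ⊗ (y ⟶[V] e'.obj z))
        (fun z => eComp V x y (e'.obj z)) (Family.whiskerLeft P (x ⟶[V] y) (ε.app y)) := by
  have h := ε.natural_left x y
  rwa [funext (representable_lact e x y), funext (representable_lact e' x y)] at h

section Universal

variable {A E C D D' : VCat.{w, v, u} V} {j : EnrichedFunctor V A E} {T : RelativeMonad j}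

/-- Each hom-morphism of the underlying `V`-functor of `U` is a universal graded homomorphism. -/
structure TAlgebra.IsUniversal (U : TAlgebra T C) : Prop where
  mono : ∀ c c' : C, Mono (U.e.map c c')
  factors : ∀ (c c' : C) (v : V) (h : v ⟶ (U.e.obj c ⟶[V] U.e.obj c')),
    IsGradedHom (U.at c) (U.at c') h → ∃ k, k ≫ U.e.map c c' = h

/-- The restriction of a family along the hom-morphisms of a `V`-functor. -/
abbrev Family.restrict {P : Chain V D D'} (u : EnrichedFunctor V C E) (F : D → C) (F' : D' → C)
    (ε : ∀ x : E, Family P (fun z => x ⟶[V] u.obj (F z)) (fun z => x ⟶[V] u.obj (F' z))) (c : C) :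
    Family P (fun z => c ⟶[V] F z) (fun z => u.obj c ⟶[V] u.obj (F' z)) :=
  Family.precomp P (fun z => u.map c (F z)) (ε (u.obj c))

/-- By left naturality, composing the restriction at `c` with `E(x, uc)` gives back what `ε x` does
on composites through `uc`. -/
theorem Family.postcomp_whiskerLeft_restrict {P : Chain V D D'} (u : EnrichedFunctor V C E)
    (F : D → C) (F' : D' → C)
    (ε : ∀ x : E, Family P (fun z => x ⟶[V] u.obj (F z)) (fun z => x ⟶[V] u.obj (F' z)))
    (hε : ∀ x y : E, Family.precomp P (fun z => eComp V x y (u.obj (F z))) (ε x) =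
      Family.postcomp P (fun z => eComp V x y (u.obj (F' z)))
        (Family.whiskerLeft P (x ⟶[V] y) (ε y))) (x : E) (c : C) :
    Family.postcomp P (fun z => eComp V x (u.obj c) (u.obj (F' z)))
      (Family.whiskerLeft P (x ⟶[V] u.obj c) (Family.restrict u F F' ε c)) =
    Family.precomp P (fun z => (x ⟶[V] u.obj c) ◁ u.map c (F z) ≫ eComp V x (u.obj c) _)
      (ε x) := by
  rw [Family.whiskerLeft_precomp, Family.postcomp_precomp, ← hε, Family.precomp_precomp]

/-- The two sides of the homomorphism condition become `ε` at `T.t.obj x` and at `j.obj x`. The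
graded morphism condition `hg` relates these, and the remaining discrepancy is that `U.e.map` is
itself a graded homomorphism. -/
theorem Family.all_isGradedHom_restrict {P : Chain V D D'} (U : TAlgebra T C)
    (F : D → C) (F' : D' → C)
    (ε : ∀ x : E, Family P (fun z => x ⟶[V] U.e.obj (F z)) (fun z => x ⟶[V] U.e.obj (F' z)))
    (hε : ∀ x y : E, Family.precomp P (fun z => eComp V x y (U.e.obj (F z))) (ε x) =
      Family.postcomp P (fun z => eComp V x y (U.e.obj (F' z)))
        (Family.whiskerLeft P (x ⟶[V] y) (ε y)))
    (hg : ∀ x : A, Family.precomp P (fun z => U.ext x (F z)) (ε (T.t.obj x)) =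
      Family.postcomp P (fun z => U.ext x (F' z)) (ε (j.obj x))) (c : C) :
    Family.All P (fun z _ h => IsGradedHom (U.at c) (U.at (F' z)) h)
      (Family.restrict U.e F F' ε c) := by
  refine Family.all_forall P fun x => ?_
  apply Family.all_of_whiskerLeft P (U.ext x c)
    (fun z => eComp V (T.t.obj x) (U.e.obj c) (U.e.obj (F' z)))
    (fun z => eComp V (j.obj x) (U.e.obj c) (U.e.obj (F' z)) ≫ U.ext x (F' z))
  rw [Family.postcomp_whiskerLeft_restrict U.e F F' ε hε, ← Family.postcomp_postcomp,
    Family.postcomp_whiskerLeft_restrict U.e F F' ε hε, Family.postcomp_precomp, ← hg,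
    Family.precomp_precomp, Family.precomp_precomp]
  congr 1
  funext z
  exact ((U.isGradedHom_map c (F z)) x).trans (Category.assoc _ _ _).symm

/-- Yoneda: evaluating the pasting equation at the identity of `uc` determines `α` after composition
with `u`, hence determines `α` when the hom-morphisms of `u` are monic. -/
theorem IsPasting.postcomp_app {u : EnrichedFunctor V C E} {F : EnrichedFunctor V D C}
    {F' : EnrichedFunctor V D' C} {P : Chain V D D'}
    {α : VForm (representable F) P (representable F')}
    {ε : VForm (representable (F.comp V u)) P (representable (F'.comp V u))}
    (h : IsPasting u F F' P α ε) (c : C) :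
    Family.postcomp P (fun z => u.map c (F'.obj z)) (α.app c) =
      Family.restrict u F.obj F'.obj ε.app c := by
  have h' := congrArg (Family.precomp P
    (fun z => (λ_ (c ⟶[V] F.obj z)).inv ≫ eId V (u.obj c) ▷ _)) (h (u.obj c) c)
  have key : ∀ c', (λ_ (c ⟶[V] c')).inv ≫ eId V (u.obj c) ▷ (c ⟶[V] c') ≫
      (u.obj c ⟶[V] u.obj c) ◁ u.map c c' ≫ eComp V _ _ _ = u.map c c' := by
    intro c'
    rw [← whisker_exchange_assoc, ← leftUnitor_inv_naturality_assoc, e_id_comp, Category.comp_id]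
  refine Eq.trans ?_ (h'.symm.trans ?_)
  · refine Eq.trans ?_ (Family.yoneda P _ _ _).symm
    congr 1
    funext z
    exact (key (F'.obj z)).symm
  · refine (Family.precomp_precomp P _ _ _).trans ?_
    congr 1
    funext z
    exact (Category.assoc _ _ _).trans (key (F.obj z))

theorem TAlgebra.IsUniversal.exists_family {U : TAlgebra T C} (hU : U.IsUniversal)
    {P : Chain V D D'} (F : D → C) (F' : D' → C)
    (ε : ∀ x : E, Family P (fun z => x ⟶[V] U.e.obj (F z)) (fun z => x ⟶[V] U.e.obj (F' z)))
    (hε : ∀ x y : E, Family.precomp P (fun z => eComp V x y (U.e.obj (F z))) (ε x) =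
      Family.postcomp P (fun z => eComp V x y (U.e.obj (F' z)))
        (Family.whiskerLeft P (x ⟶[V] y) (ε y)))
    (hg : ∀ x : A, Family.precomp P (fun z => U.ext x (F z)) (ε (T.t.obj x)) =
      Family.postcomp P (fun z => U.ext x (F' z)) (ε (j.obj x))) :
    ∃ ψ : ∀ c : C, Family P (fun z => c ⟶[V] F z) (fun z => c ⟶[V] F' z),
      (∀ c, Family.postcomp P (fun z => U.e.map c (F' z)) (ψ c) =
        Family.restrict U.e F F' ε c) ∧
      (∀ (x : E) (c : C), Family.precomp P
          (fun z => (x ⟶[V] U.e.obj c) ◁ U.e.map c (F z) ≫ eComp V x _ _) (ε x) =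
        Family.postcomp P (fun z => (x ⟶[V] U.e.obj c) ◁ U.e.map c (F' z) ≫ eComp V x _ _)
          (Family.whiskerLeft P (x ⟶[V] U.e.obj c) (ψ c))) ∧
      ∀ c c' : C, Family.precomp P (fun z => eComp V c c' (F z)) (ψ c) =
        Family.postcomp P (fun z => eComp V c c' (F' z))
          (Family.whiskerLeft P (c ⟶[V] c') (ψ c')) := by
  have := hU.mono
  choose ψ hψ using fun c => Family.All.exists_postcomp_eq P (fun z => U.e.map c (F' z))
    (Family.All.mono P (fun z v h => hU.factors c (F' z) v h)
      (Family.all_isGradedHom_restrict U F F' ε hε hg c))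
  have key : ∀ (x : E) (c : C), Family.precomp P
      (fun z => (x ⟶[V] U.e.obj c) ◁ U.e.map c (F z) ≫ eComp V x _ _) (ε x) =
      Family.postcomp P (fun z => (x ⟶[V] U.e.obj c) ◁ U.e.map c (F' z) ≫ eComp V x _ _)
        (Family.whiskerLeft P (x ⟶[V] U.e.obj c) (ψ c)) := by
    intro x c
    rw [← Family.postcomp_whiskerLeft_restrict U.e F F' ε hε, ← hψ,
      Family.whiskerLeft_postcomp, Family.postcomp_postcomp]
  refine ⟨ψ, hψ, key, fun c c' => ?_⟩
  apply Family.postcomp_injective P (fun z => U.e.map c (F' z))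
  rw [Family.postcomp_precomp, hψ, Family.postcomp_postcomp, Family.precomp_precomp]
  -- Left naturality, after composing with the monomorphism, is the pasting equation at `uc`
  -- restricted along `C(c, c') ⟶ E(uc, uc')`, by functoriality of `U.e`.
  have h := congrArg (Family.precomp P (fun z => U.e.map c c' ▷ (c' ⟶[V] F z)))
    (key (U.e.obj c) c')
  rw [← Family.postcomp_precomp, Family.precomp_whiskerRight_whiskerLeft,
    Family.postcomp_postcomp, Family.precomp_precomp] at h
  simp only [EnrichedFunctor.map_comp, MonoidalCategory.tensorHom_def, Category.assoc]
  exact h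

theorem TAlgebra.IsUniversal.existsUnique_isPasting {U : TAlgebra T C} (hU : U.IsUniversal)
    {P : Chain V D D'} (F : EnrichedFunctor V D C) (F' : EnrichedFunctor V D' C)
    (ε : VForm (representable (F.comp V U.e)) P (representable (F'.comp V U.e)))
    (hg : IsGradedMorphism (U.pullback F) (U.pullback F') P ε) :
    ∃! α : VForm (representable F) P (representable F'), IsPasting U.e F F' P α ε := by
  have := hU.mono
  obtain ⟨ψ, hψ, key, hleft⟩ := hU.exists_family F.obj F'.obj ε.app
    ε.natural_left_representable hg
  refine ⟨⟨ψ, fun c c' => ?_, fun c => ?_⟩, key, fun α hα => ?_⟩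
  · rw [funext (representable_lact F c c'), funext (representable_lact F' c c')]
    exact hleft c c'
  -- The hom-morphisms of `U.e` are equivariant for the right actions, so right naturality passes
  -- from `ε` to its restriction and then back through the monomorphisms.
  · have hact : ∀ {B : VCat.{w, v, u} V} (f : EnrichedFunctor V B C) (z z' : B),
        (representable f).ract c z z' ≫ U.e.map c (f.obj z') =
          U.e.map c (f.obj z) ▷ (z ⟶[V] z') ≫
            (representable (f.comp V U.e)).ract (U.e.obj c) z z' := by
      intro B f z z'
      change ((c ⟶[V] f.obj z) ◁ f.map z z' ≫ eComp V _ _ _) ≫ U.e.map c (f.obj z') =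
        U.e.map c (f.obj z) ▷ (z ⟶[V] z') ≫
          (_ ◁ (f.map z z' ≫ U.e.map (f.obj z) (f.obj z')) ≫ eComp V _ _ _)
      rw [Category.assoc, U.e.map_comp, MonoidalCategory.whiskerLeft_comp, Category.assoc,
        ← whisker_exchange_assoc, MonoidalCategory.tensorHom_def, Category.assoc,
        ← whisker_exchange_assoc]
    apply Family.Natural.of_postcomp P (fun z => U.e.map c (F'.obj z)) (hact F')
    exact (congrArg (Family.Natural P _ _) (hψ c)).mpr
      (Family.Natural.precomp P _ (hact F) (ε.natural_right (U.e.obj c)))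
  · apply VForm.ext_app
    funext c
    exact Family.postcomp_injective P (fun z => U.e.map c (F'.obj z))
      ((hα.postcomp_app c).trans (hψ c).symm)

end Universal

/-! ### The Eilenberg–Moore category as an algebra object, and uniqueness -/

variable {A E : VCat.{w, v, max u w} V} {j : EnrichedFunctor V A E} {T : RelativeMonad j}

/-- The comparison `V`-functor into the Eilenberg–Moore `V`-category. -/
noncomputable def EMComparison (𝒰 : ∀ a b : EMAlgebra T, UniversalGradedHom a b)
    {D : VCat.{w, v, max u w} V} (X : TAlgebra T D) :
    EnrichedFunctor V D (EMCat.{w, v, u} 𝒰) where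
  obj z := X.at z
  map z z' := (𝒰 (X.at z) (X.at z')).lift _ (X.isGradedHom_map z z')
  map_id z := by
    apply (𝒰 (X.at z) (X.at z)).hom_ext
    change (eId V z ≫ (𝒰 (X.at z) (X.at z)).lift _ (X.isGradedHom_map z z)) ≫ _ =
      (𝒰 (X.at z) (X.at z)).lift _ (isGradedHom_id (X.at z)) ≫ _
    rw [Category.assoc, UniversalGradedHom.lift_hom, UniversalGradedHom.lift_hom, X.e.map_id]
  map_comp z z' z'' := by
    apply (𝒰 (X.at z) (X.at z'')).hom_ext
    change (eComp V z z' z'' ≫ (𝒰 (X.at z) (X.at z'')).lift _ (X.isGradedHom_map z z'')) ≫ _ =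
      (((𝒰 (X.at z) (X.at z')).lift _ (X.isGradedHom_map z z') ⊗ₘ
        (𝒰 (X.at z') (X.at z'')).lift _ (X.isGradedHom_map z' z'')) ≫
        (𝒰 (X.at z) (X.at z'')).lift _ (isGradedHom_comp (𝒰 (X.at z) (X.at z')).isGradedHom
          (𝒰 (X.at z') (X.at z'')).isGradedHom)) ≫ _
    rw [Category.assoc, UniversalGradedHom.lift_hom, Category.assoc, UniversalGradedHom.lift_hom,
      X.e.map_comp, MonoidalCategory.tensorHom_comp_tensorHom_assoc, UniversalGradedHom.lift_hom,
      UniversalGradedHom.lift_hom]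

theorem EMTAlgebra_pullback_comparison (𝒰 : ∀ a b : EMAlgebra T, UniversalGradedHom a b)
    {D : VCat.{w, v, max u w} V} (X : TAlgebra T D) :
    (EMTAlgebra.{w, v, u} 𝒰).pullback (EMComparison 𝒰 X) = X := by
  refine TAlgebra.ext_of_heq (EnrichedFunctor.ext_map rfl (heq_of_eq ?_)) HEq.rfl
  funext z z'
  exact (𝒰 (X.at z) (X.at z')).lift_hom _ (X.isGradedHom_map z z')

/-- The functors agree on objects definitionally, and a morphism into a universal domain is
determined by its composite with the universal homomorphism. -/
theorem EMComparison_pullback (𝒰 : ∀ a b : EMAlgebra T, UniversalGradedHom a b)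
    {D : VCat.{w, v, max u w} V} (F : EnrichedFunctor V D (EMCat.{w, v, u} 𝒰)) :
    EMComparison 𝒰 ((EMTAlgebra.{w, v, u} 𝒰).pullback F) = F := by
  refine EnrichedFunctor.ext_map rfl (heq_of_eq ?_)
  funext z z'
  exact (𝒰 (F.obj z) (F.obj z')).hom_ext (UniversalGradedHom.lift_hom _ _
    (((EMTAlgebra.{w, v, u} 𝒰).pullback F).isGradedHom_map z z'))

theorem EMTAlgebra_isUniversal (𝒰 : ∀ a b : EMAlgebra T, UniversalGradedHom a b) :
    (EMTAlgebra.{w, v, u} 𝒰).IsUniversal where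
  mono a b := (𝒰 a b).mono_hom
  factors a b v h hh := ((𝒰 a b).existsUnique v h hh).exists

theorem EMTAlgebra_isAlgebraObject (𝒰 : ∀ a b : EMAlgebra T, UniversalGradedHom a b) :
    IsAlgebraObject (EMTAlgebra.{w, v, u} 𝒰) where
  lift D X := ⟨EMComparison 𝒰 X, EMTAlgebra_pullback_comparison 𝒰 X, by
    rintro F rfl; exact (EMComparison_pullback 𝒰 F).symm⟩
  lift_hom _ _ _ F F' ε hε := (EMTAlgebra_isUniversal 𝒰).existsUnique_isPasting F F' ε hε

theorem TAlgebra.pullback_comp {A E C D D' : VCat.{w, v, u} V} {j : EnrichedFunctor V A E}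
    {T : RelativeMonad j} (X : TAlgebra T C) (F : EnrichedFunctor V D C)
    (G : EnrichedFunctor V D' D) : X.pullback (G.comp V F) = (X.pullback F).pullback G :=
  TAlgebra.ext_of_heq (EnrichedFunctor.ext_map rfl (heq_of_eq (by
    funext z z'; exact Category.assoc _ _ _))) HEq.rfl

theorem TAlgebra.pullback_id {A E C : VCat.{w, v, u} V} {j : EnrichedFunctor V A E}
    {T : RelativeMonad j} (X : TAlgebra T C) : X.pullback (EnrichedFunctor.id V C) = X :=
  TAlgebra.ext_of_heq (EnrichedFunctor.ext_map rfl (heq_of_eq (by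
    funext z z'; exact Category.id_comp _))) HEq.rfl

/-- The usual uniqueness argument; the one-dimensional property `lift` alone suffices. -/
theorem IsAlgebraObject.exists_iso {A E C C' : VCat.{w, v, u} V} {j : EnrichedFunctor V A E}
    {T : RelativeMonad j} {U : TAlgebra T C} {U' : TAlgebra T C'} (hU : IsAlgebraObject U)
    (hU' : IsAlgebraObject U') :
    ∃ (F : EnrichedFunctor V C C') (G : EnrichedFunctor V C' C),
      F.comp V G = EnrichedFunctor.id V C ∧ G.comp V F = EnrichedFunctor.id V C' ∧
        U'.pullback F = U := by
  obtain ⟨F, hF, -⟩ := hU'.lift C U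
  obtain ⟨G, hG, -⟩ := hU.lift C' U'
  refine ⟨F, G, (hU.lift C U).unique ?_ U.pullback_id, (hU'.lift C' U').unique ?_ U'.pullback_id,
    hF⟩
  · rw [TAlgebra.pullback_comp, hG, hF]
  · rw [TAlgebra.pullback_comp, hF, hG]

end AlgebraObjects

/-! ### Test data on the unit category -/

section UnitVCat

variable {V : Type v} [Category.{w} V] [MonoidalCategory V]

theorem e_comp_id_hom {C : VCat.{w, v, u} V} (x y : C) :
    (x ⟶[V] y) ◁ eId V y ≫ eComp V x y y = (ρ_ (x ⟶[V] y)).hom := by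
  have h := e_comp_id V x y
  rwa [Iso.inv_comp_eq, Category.comp_id] at h

theorem e_id_comp_hom {C : VCat.{w, v, u} V} (x y : C) :
    eId V x ▷ (x ⟶[V] y) ≫ eComp V x x y = (λ_ (x ⟶[V] y)).hom := by
  have h := e_id_comp V x y
  rwa [Iso.inv_comp_eq, Category.comp_id] at h

theorem eId_tensorHom_eId_comp {C : VCat.{w, v, u} V} (x : C) :
    (eId V x ⊗ₘ eId V x) ≫ eComp V x x x = (λ_ (𝟙_ V)).hom ≫ eId V x := by
  rw [MonoidalCategory.tensorHom_def', Category.assoc, e_id_comp_hom, leftUnitor_naturality]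

variable (V) in
/-- The unit `V`-category, with one object. -/
def unitVCat : VCat.{w, v, u} V where
  Obj := PUnit
  str :=
    { Hom _ _ := 𝟙_ V
      id _ := 𝟙 _
      comp _ _ _ := (λ_ (𝟙_ V)).hom
      id_comp _ _ := by monoidal
      comp_id _ _ := by monoidal
      assoc _ _ _ _ := by monoidal }

/-- The `V`-functor from the unit `V`-category that picks out an object. -/
abbrev point {C : VCat.{w, v, u} V} (c : C) : EnrichedFunctor V (unitVCat.{w, v, u} V) C where
  obj _ := c
  map _ _ := eId V c
  map_id _ := Category.id_comp _
  map_comp _ _ _ := (eId_tensorHom_eId_comp c).symm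

/-- The `V`-distributor on the unit `V`-category given by an object of `V`. -/
abbrev constDist (x : V) : Distributor (unitVCat.{w, v, u} V) (unitVCat.{w, v, u} V) where
  obj _ _ := x
  lact _ _ _ := (λ_ x).hom
  ract _ _ _ := (ρ_ x).hom
  lact_id _ _ := by
    change (λ_ x).inv ≫ 𝟙 (𝟙_ V) ▷ x ≫ (λ_ x).hom = _
    simp
  lact_comp _ _ _ _ := by
    change (λ_ (𝟙_ V)).hom ▷ x ≫ (λ_ x).hom = (α_ _ _ _).hom ≫ 𝟙_ V ◁ (λ_ x).hom ≫ (λ_ x).hom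
    monoidal
  ract_id _ _ := by
    change (ρ_ x).inv ≫ x ◁ 𝟙 (𝟙_ V) ≫ (ρ_ x).hom = _
    simp
  ract_comp _ _ _ _ := by
    change x ◁ (λ_ (𝟙_ V)).hom ≫ (ρ_ x).hom = (α_ _ _ _).inv ≫ (ρ_ x).hom ▷ 𝟙_ V ≫ (ρ_ x).hom
    monoidal
  lact_ract _ _ _ _ := by
    change (λ_ x).hom ▷ 𝟙_ V ≫ (ρ_ x).hom = (α_ _ _ _).hom ≫ 𝟙_ V ◁ (ρ_ x).hom ≫ (λ_ x).hom
    monoidal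

theorem unitVCat_map {C : VCat.{w, v, u} V} (f : EnrichedFunctor V (unitVCat.{w, v, u} V) C) :
    f.map ⟨⟩ ⟨⟩ = eId V (f.obj ⟨⟩) :=
  (Category.id_comp _).symm.trans (f.map_id ⟨⟩)

theorem representable_unit_ract {C : VCat.{w, v, u} V}
    (f : EnrichedFunctor V (unitVCat.{w, v, u} V) C) (x : C) (z z' : unitVCat.{w, v, u} V) :
    (representable f).ract x z z' = (ρ_ (x ⟶[V] f.obj ⟨⟩)).hom :=
  (congrArg (fun k => (x ⟶[V] f.obj ⟨⟩) ◁ k ≫ eComp V _ _ _) (unitVCat_map f)).trans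
    (e_comp_id_hom x (f.obj ⟨⟩))

theorem whiskerLeft_comp_eComp {C : VCat.{w, v, u} V} {x y z z' : C} {a : V}
    (k : a ⟶ (z ⟶[V] z')) :
    eComp V x y z ▷ a ≫ (x ⟶[V] z) ◁ k ≫ eComp V x z z' =
      (α_ _ _ _).hom ≫ (x ⟶[V] y) ◁ ((y ⟶[V] z) ◁ k ≫ eComp V y z z') ≫ eComp V x y z' := by
  rw [← whisker_exchange_assoc, MonoidalCategory.whiskerLeft_comp, Category.assoc, ← e_assoc]
  simp

/-- The `V`-form given by composition with `k`. -/
def pointForm {C : VCat.{w, v, u} V} (f f' : EnrichedFunctor V (unitVCat.{w, v, u} V) C) {a : V}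
    (k : a ⟶ (f.obj ⟨⟩ ⟶[V] f'.obj ⟨⟩)) :
    VForm (representable f) (.cons (constDist a) (.nil _)) (representable f') where
  app x := fun _ _ => (x ⟶[V] f.obj ⟨⟩) ◁ k ≫ eComp V x (f.obj ⟨⟩) (f'.obj ⟨⟩)
  natural_left x y := by
    rw [funext (representable_lact f x y), funext (representable_lact f' x y)]
    funext z z'
    exact (whiskerLeft_comp_eComp k).trans (Category.assoc _ _ _).symm
  natural_right x := by
    rw [funext₂ (representable_unit_ract f x), funext₂ (representable_unit_ract f' x)]
    refine ⟨fun z z' => ?_, fun z z' z'' => ?_⟩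
    · funext y
      change (ρ_ (x ⟶[V] f.obj ⟨⟩)).hom ▷ a ≫ (x ⟶[V] f.obj ⟨⟩) ◁ k ≫ eComp V _ _ _ =
        ((α_ (x ⟶[V] f.obj ⟨⟩) (𝟙_ V) a).hom ≫ (x ⟶[V] f.obj ⟨⟩) ◁ (λ_ a).hom) ≫
          (x ⟶[V] f.obj ⟨⟩) ◁ k ≫ eComp V _ _ _
      simp
    · change ((α_ (x ⟶[V] f.obj ⟨⟩) a (𝟙_ V)).hom ≫ (x ⟶[V] f.obj ⟨⟩) ◁ (ρ_ a).hom) ≫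
          (x ⟶[V] f.obj ⟨⟩) ◁ k ≫ eComp V _ _ _ =
        ((x ⟶[V] f.obj ⟨⟩) ◁ k ≫ eComp V _ _ _) ▷ 𝟙_ V ≫ (ρ_ _).hom
      simp

/-- Evaluation at the identity recovers `k` from `pointForm`. -/
theorem leftUnitor_inv_id_whiskerLeft_comp {C : VCat.{w, v, u} V} {z z' : C} {a : V}
    (k : a ⟶ (z ⟶[V] z')) :
    ((λ_ a).inv ≫ eId V z ▷ a) ≫ (z ⟶[V] z) ◁ k ≫ eComp V z z z' = k := by
  rw [Category.assoc, ← whisker_exchange_assoc, ← leftUnitor_inv_naturality_assoc, e_id_comp,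
    Category.comp_id]

theorem isPasting_pointForm {C E : VCat.{w, v, u} V} (e : EnrichedFunctor V C E)
    (f f' : EnrichedFunctor V (unitVCat.{w, v, u} V) C) {a : V}
    (k : a ⟶ (f.obj ⟨⟩ ⟶[V] f'.obj ⟨⟩)) (h : a ⟶ (e.obj (f.obj ⟨⟩) ⟶[V] e.obj (f'.obj ⟨⟩)))
    (hk : k ≫ e.map _ _ = h) :
    IsPasting e f f' _ (pointForm f f' k) (pointForm (f.comp V e) (f'.comp V e) h) := by
  subst hk
  intro x y
  funext z z'
  change ((x ⟶[V] e.obj y) ◁ e.map y (f.obj ⟨⟩) ≫ eComp V _ _ _) ▷ a ≫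
    (x ⟶[V] e.obj (f.obj ⟨⟩)) ◁ (k ≫ e.map (f.obj ⟨⟩) (f'.obj ⟨⟩)) ≫ eComp V _ _ _ =
    ((α_ _ _ _).hom ≫ (x ⟶[V] e.obj y) ◁ ((y ⟶[V] f.obj ⟨⟩) ◁ k ≫ eComp V _ _ _)) ≫
      (x ⟶[V] e.obj y) ◁ e.map y (f'.obj ⟨⟩) ≫ eComp V _ _ _
  rw [comp_whiskerRight, Category.assoc, whiskerLeft_comp_eComp, Category.assoc,
    ← MonoidalCategory.whiskerLeft_comp_assoc, Category.assoc, e.map_comp,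
    MonoidalCategory.tensorHom_def]
  simp [whisker_exchange_assoc]

end UnitVCat

/-! ### Necessity of universal homomorphisms, and the existence criterion -/

section AdmitsAlgebraObject

variable {V : Type v} [Category.{w} V] [MonoidalCategory V]

theorem isGradedMorphism_pointForm {A E C : VCat.{w, v, u} V} {j : EnrichedFunctor V A E}
    {T : RelativeMonad j} (U : TAlgebra T C) {c c' : C} {a : V}
    {h : a ⟶ (U.e.obj c ⟶[V] U.e.obj c')} (hh : IsGradedHom (U.at c) (U.at c') h) :
    IsGradedMorphism (U.pullback (point c)) (U.pullback (point c')) _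
      (pointForm ((point c).comp V U.e) ((point c').comp V U.e) h) := by
  intro x
  funext z z'
  exact (hh x).trans (Category.assoc _ _ _).symm

theorem VPresheaf.IsNatural.precomp {Z : VCat.{w, v, u} V} {p q : VPresheaf Z} {a b : V}
    {φ : ∀ z, p.obj z ⊗ a ⟶ q.obj z} (hφ : p.IsNatural q φ) (k : b ⟶ a) :
    p.IsNatural q fun z => p.obj z ◁ k ≫ φ z := by
  intro z' z
  have h := hφ z' z
  rw [← whisker_exchange_assoc, h]
  simp

/-- Uniqueness in `lift_hom`, applied to point forms, gives monicity; existence gives factorisation.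
-/
theorem IsAlgebraObject.isUniversal {A E C : VCat.{w, v, u} V} {j : EnrichedFunctor V A E}
    {T : RelativeMonad j} {U : TAlgebra T C} (hU : IsAlgebraObject U) : U.IsUniversal where
  mono c c' := by
    refine ⟨fun {a} k k' h => ?_⟩
    have hk := isPasting_pointForm U.e (point c) (point c') k _ rfl
    have hk' := isPasting_pointForm U.e (point c) (point c') k' _ h.symm
    -- Both point forms paste to the same graded morphism, hence coincide.
    have hkk' := (hU.lift_hom _ _ _ _ _ _ (isGradedMorphism_pointForm U
      ((U.isGradedHom_map c c').precomp k))).unique hk hk'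
    have happ : (c ⟶[V] c) ◁ k ≫ eComp V c c c' = (c ⟶[V] c) ◁ k' ≫ eComp V c c c' :=
      congrArg (fun α => α.app c ⟨⟩ ⟨⟩) hkk'
    rw [← leftUnitor_inv_id_whiskerLeft_comp k, happ, leftUnitor_inv_id_whiskerLeft_comp]
  factors c c' a h hh := by
    obtain ⟨α, hα, -⟩ := hU.lift_hom _ _ _ _ _ _ (isGradedMorphism_pointForm U hh)
    obtain ⟨m, hm⟩ : ∃ m : (c ⟶[V] c) ⊗ a ⟶ (c ⟶[V] c'), m ≫ U.e.map c c' =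
        U.e.map c c ▷ a ≫ (U.e.obj c ⟶[V] U.e.obj c) ◁ h ≫ eComp V _ _ _ :=
      ⟨α.app c ⟨⟩ ⟨⟩, congrFun (congrFun (hα.postcomp_app c) ⟨⟩) ⟨⟩⟩
    -- The factorisation is the form `α` evaluated at the identity of `c`.
    refine ⟨((λ_ a).inv ≫ eId V c ▷ a) ≫ m, ?_⟩
    rw [Category.assoc, hm, Category.assoc, ← comp_whiskerRight_assoc, U.e.map_id,
      ← Category.assoc, leftUnitor_inv_id_whiskerLeft_comp]

/-- The universal graded homomorphisms given by the hom-morphisms of a universal algebra. -/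
def TAlgebra.IsUniversal.universalGradedHom {A E C : VCat.{w, v, u} V}
    {j : EnrichedFunctor V A E} {T : RelativeMonad j} {U : TAlgebra T C} (hU : U.IsUniversal)
    (c c' : C) : UniversalGradedHom (U.at c) (U.at c') where
  obj := c ⟶[V] c'
  hom := U.e.map c c'
  isGradedHom := U.isGradedHom_map c c'
  existsUnique a h hh :=
    have := hU.mono c c'
    (existsUnique_of_exists_of_unique (hU.factors c c' a h hh)
      fun _ _ hk hk' => (cancel_mono (U.e.map c c')).1 (hk.trans hk'.symm))

variable {A E : VCat.{w, v, max u w} V} {j : EnrichedFunctor V A E} {T : RelativeMonad j}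

/-- An Eilenberg–Moore algebra, as a `T`-algebra on the unit `V`-category. -/
def EMAlgebra.toTAlgebra (a : EMAlgebra T) : TAlgebra T (unitVCat.{w, v, max u w} V) where
  e := point a.carrier
  ext x _ := a.ext x
  natural_left x y _ := EMAlgebra.ext_natural.{w, v, u} a x y
  natural_right x _ _ := by
    change (_ ◁ eId V a.carrier ≫ eComp V _ _ _) ≫ a.ext x =
      a.ext x ▷ 𝟙_ V ≫ _ ◁ eId V a.carrier ≫ eComp V _ _ _
    rw [e_comp_id_hom, e_comp_id_hom, rightUnitor_naturality]
  unit x _ := a.unit x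
  assoc x y _ := a.assoc x y

theorem IsAlgebraObject.exists_at_eq {C : VCat.{w, v, max u w} V} {U : TAlgebra T C}
    (hU : IsAlgebraObject U) (a : EMAlgebra T) : ∃ c, U.at c = a := by
  obtain ⟨F, hF, -⟩ := hU.lift _ (EMAlgebra.toTAlgebra.{w, v, u} a)
  exact ⟨F.obj ⟨⟩, congrArg (fun X : TAlgebra T (unitVCat V) => X.at PUnit.unit) hF⟩

theorem admitsAlgebraObject_iff (T : RelativeMonad j) :
    AdmitsAlgebraObject T ↔ ∀ a b : EMAlgebra T, Nonempty (UniversalGradedHom a b) := by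
  constructor
  · rintro ⟨C, U, hU⟩ a b
    obtain ⟨c, rfl⟩ := IsAlgebraObject.exists_at_eq.{w, v, u} hU a
    obtain ⟨c', rfl⟩ := IsAlgebraObject.exists_at_eq.{w, v, u} hU b
    exact ⟨hU.isUniversal.universalGradedHom c c'⟩
  · intro h
    exact ⟨_, _, EMTAlgebra_isAlgebraObject.{w, v, u} fun a b => (h a b).some⟩

/-- Both sides of the homomorphism condition are natural families `E(jx, a) ⊗ E(a, b) ⟶ E(tx, b)`
precomposed with `h`. They correspond to `k, l : E(a, b) ⟶ N`, and the equaliser of `k` and `l` is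
universal. -/
theorem nonempty_universalGradedHom [HasEqualizers V]
    (hN : ∀ (e : E) (q : VPresheaf A), (nervePresheaf j e).HasNatObj q) (a b : EMAlgebra T) :
    Nonempty (UniversalGradedHom a b) := by
  obtain ⟨N, ϖ, hnat, hϖ⟩ := hN a.carrier (nervePresheaf T.t b.carrier)
  have natural_comp : ∀ (t : EnrichedFunctor V A E) (x y : A),
      (t.map x y ▷ (t.obj y ⟶[V] a.carrier) ≫ eComp V _ _ _) ▷ (a.carrier ⟶[V] b.carrier) ≫
        eComp V (t.obj x) a.carrier b.carrier =
      (α_ _ _ _).hom ≫ (x ⟶[V] y) ◁ eComp V (t.obj y) a.carrier b.carrier ≫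
        t.map x y ▷ (t.obj y ⟶[V] b.carrier) ≫ eComp V _ _ _ := by
    intro t x y
    have h := e_assoc V (t.obj x) (t.obj y) a.carrier b.carrier
    rw [Iso.inv_comp_eq] at h
    rw [comp_whiskerRight, Category.assoc, h, whisker_exchange_assoc]
    simp
  -- `k` classifies extending in `a` and then composing; `l` below classifies composing and then
  -- extending in `b`.
  obtain ⟨k, hk, -⟩ := hϖ _ (fun x => a.ext x ▷ (a.carrier ⟶[V] b.carrier) ≫ eComp V _ _ _) (by
    intro x y
    have h := congrArg (fun f => f ▷ (a.carrier ⟶[V] b.carrier))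
      (EMAlgebra.ext_natural.{w, v, u} a x y)
    have h' := natural_comp T.t x y
    simp only [comp_whiskerRight, Category.assoc] at h h'
    change (j.map x y ▷ _ ≫ eComp V _ _ _) ▷ _ ≫ a.ext x ▷ _ ≫ eComp V _ _ _ =
      (α_ _ _ _).hom ≫ (x ⟶[V] y) ◁ (a.ext y ▷ _ ≫ eComp V _ _ _) ≫
        T.t.map x y ▷ _ ≫ eComp V _ _ _
    simp only [comp_whiskerRight, Category.assoc, MonoidalCategory.whiskerLeft_comp]
    rw [reassoc_of% h, h']
    simp)
  obtain ⟨l, hl, -⟩ := hϖ _ (fun x => eComp V _ a.carrier b.carrier ≫ b.ext x) (by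
    intro x y
    have h := natural_comp j x y
    have h' := EMAlgebra.ext_natural.{w, v, u} b x y
    simp only [Category.assoc] at h'
    change (j.map x y ▷ _ ≫ eComp V _ _ _) ▷ _ ≫ eComp V _ _ _ ≫ b.ext x =
      (α_ _ _ _).hom ≫ (x ⟶[V] y) ◁ (eComp V _ _ _ ≫ b.ext y) ≫
        T.t.map x y ▷ _ ≫ eComp V _ _ _
    rw [reassoc_of% h, h', MonoidalCategory.whiskerLeft_comp, Category.assoc])
  have iff : ∀ {d : V} (h : d ⟶ (a.carrier ⟶[V] b.carrier)),
      IsGradedHom a b h ↔ h ≫ k = h ≫ l := by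
    intro d h
    have h₁ : ∀ x, (j.obj x ⟶[V] a.carrier) ◁ (h ≫ k) ≫ ϖ x =
        a.ext x ▷ d ≫ (T.t.obj x ⟶[V] a.carrier) ◁ h ≫ eComp V _ _ _ := by
      intro x
      refine (congrArg (· ≫ ϖ x) (MonoidalCategory.whiskerLeft_comp _ h k)).trans ?_
      exact (Category.assoc _ _ _).trans ((congrArg _ (hk x)).trans (whisker_exchange_assoc _ _ _))
    have h₂ : ∀ x, (j.obj x ⟶[V] a.carrier) ◁ (h ≫ l) ≫ ϖ x =
        (j.obj x ⟶[V] a.carrier) ◁ h ≫ eComp V _ _ _ ≫ b.ext x := by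
      intro x
      refine (congrArg (· ≫ ϖ x) (MonoidalCategory.whiskerLeft_comp _ h l)).trans ?_
      exact (Category.assoc _ _ _).trans (congrArg _ (hl x))
    refine ⟨fun hh => ?_, fun hh x => (h₁ x).symm.trans (by rw [hh]; exact h₂ x)⟩
    exact (hϖ d _ (hnat.precomp (h ≫ l))).unique
      (fun x => (h₁ x).trans ((hh x).trans (h₂ x).symm)) (fun _ => rfl)
  exact ⟨{
    obj := equalizer k l
    hom := equalizer.ι k l
    isGradedHom := (iff _).2 (equalizer.condition k l)
    existsUnique := fun d h hh => ⟨equalizer.lift h ((iff h).1 hh), equalizer.lift_ι _ _,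
      fun m hm => equalizer.hom_ext (hm.trans (equalizer.lift_ι _ _).symm)⟩ }⟩

end AdmitsAlgebraObject
end EnrichedRelMonad

theorem mainTheorem11 {V : Type v} [Category.{w} V] [MonoidalCategory V]
    {A E : VCat.{w, v, max u w} V} (j : EnrichedFunctor V A E) :
    -- `T` admits an algebra object iff universal graded homomorphisms exist
    (∀ T : RelativeMonad j,
      AdmitsAlgebraObject T ↔ ∀ a b : EMAlgebra T, Nonempty (UniversalGradedHom a b)) ∧
    -- in that case the Eilenberg–Moore `V`-category is the algebra object (up to isomorphism)
    (∀ (T : RelativeMonad j) (𝒰 : ∀ a b : EMAlgebra T, UniversalGradedHom a b),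
      IsAlgebraObject (EMTAlgebra 𝒰) ∧
      ∀ (C : VCat.{w, v, max u w} V) (U : TAlgebra T C), IsAlgebraObject U →
        ∃ (F : EnrichedFunctor V C (EMCat 𝒰)) (G : EnrichedFunctor V (EMCat 𝒰) C),
          F.comp V G = EnrichedFunctor.id V C ∧ G.comp V F = EnrichedFunctor.id V (EMCat 𝒰) ∧
          (EMTAlgebra 𝒰).pullback F = U) ∧
    -- the sufficient condition
    (HasEqualizers V →
      (∀ (e : E) (q : VPresheaf A), (nervePresheaf j e).HasNatObj q) →
      ∀ T : RelativeMonad j, AdmitsAlgebraObject T) := by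
  refine ⟨fun T => admitsAlgebraObject_iff.{w, v, u} T, fun T 𝒰 => ?_, fun _ hN T => ?_⟩
  · exact ⟨EMTAlgebra_isAlgebraObject.{w, v, u} 𝒰, fun C U hU =>
      hU.exists_iso (EMTAlgebra_isAlgebraObject.{w, v, u} 𝒰)⟩
  · exact (admitsAlgebraObject_iff.{w, v, u} T).2
      fun a b => nonempty_universalGradedHom.{w, v, u} hN a b
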